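/- Let $J\subset\mathbb R$ be compact, let $U\subset\mathbb R^3$ be an open set containing $J\times\{(0,0)\}$, and let $X,Y:U\to\mathbb R$ be $C^\infty$ functions of $(x,r_1,\epsilon_1)$ with $Y(x,0,0)>0$ for every $x\in J$. Consider the system $$\dot x=r_1^2X(x,r_1,\epsilon_1),\qquad \dot r_1=-r_1Y(x,r_1,\epsilon_1),\qquad \dot\epsilon_1=\epsilon_1Y(x,r_1,\epsilon_1)$$ on $U$, for which the points $(x,0,0)$, $x\in J$, are partially hyperbolic equilibria. Fix $n\in\mathbb N$. Then there are $\delta>0$ and an open set $V\supset J$ such that for all $r_{10},\epsilon_{10}\in(0,\delta)$ the following holds. For all $x\in V$ and $\epsilon_1\in(0,\epsilon_{10}]$ the forward trajectory in $U$ of $(x,r_{10},\epsilon_1)$ reaches $\{\epsilon_1=\epsilon_{10}\}$, so that the transition map $Q_1$ from $\{r_1=r_{10}\}$ to $\{\epsilon_1=\epsilon_{10}\}$ (the point of first arrival) is well defined there. Let $\pi_xQ_1(x,r_{10},\epsilon_1)$ be its $x$-component. 1. For every $\epsilon_1\in(0,\epsilon_{10}]$ the map $x\mapsto\pi_xQ_1(x,r_{10},\epsilon_1)$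 is $C^n$ on $V$, uniformly and continuously in $\epsilon_1$: its derivatives of orders $0,\dots,n$ are bounded on $V$ by a constant independent of $\epsilon_1\in(0,\epsilon_{10}]$, and as functions on $V$ with the supremum norm they depend continuously on $\epsilon_1\in(0,\epsilon_{10}]$. 2. There is a $C^\infty$ function $g_0:V\to\mathbb R$ such that, as $\epsilon_1\to0^+$, $$\pi_xQ_1(x,r_{10},\epsilon_1)=g_0(x)+\mathcal O(\epsilon_1\log\epsilon_1^{-1}),$$ and this expansion can be differentiated in $x$ without changing the order of the remainder: for every $0\le k\le n$, $$\partial_x^k\,\pi_xQ_1(x,r_{10},\epsilon_1)=g_0^{(k)}(x)+\mathcal O(\epsilon_1\log\epsilon_1^{-1}),$$ uniformly in $x\in V$. -/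

import Mathlib

open Set Filter Topology
open scoped ContDiff

/-- The vector field `ẋ = r₁² X`, `ṙ₁ = -r₁ Y`, `ε̇₁ = ε₁ Y` at the point `p = (x, r₁, ε₁)`. -/
def edgeField (X Y : ℝ × ℝ × ℝ → ℝ) (p : ℝ × ℝ × ℝ) : ℝ × ℝ × ℝ :=
  (p.2.1 ^ 2 * X p, -p.2.1 * Y p, p.2.2 * Y p)

/-- `q` is the first point of the section `{ε₁ = ε₁₀}` on the forward trajectory of `p`: some
trajectory runs inside `U` from `p` at time `0` to `q` at time `T ≥ 0`, and it meets the section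
at time `T` and not before. -/
def IsExitPoint (X Y : ℝ × ℝ × ℝ → ℝ) (U : Set (ℝ × ℝ × ℝ)) (e₁₀ : ℝ)
    (p q : ℝ × ℝ × ℝ) : Prop :=
  ∃ (T : ℝ) (γ : ℝ → ℝ × ℝ × ℝ), 0 ≤ T ∧
    IsIntegralCurveOn γ (fun _ => edgeField X Y) (Icc 0 T) ∧
    (∀ t ∈ Icc 0 T, γ t ∈ U) ∧
    γ 0 = p ∧ γ T = q ∧ q.2.2 = e₁₀ ∧ ∀ t ∈ Ico 0 T, (γ t).2.2 ≠ e₁₀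

open Classical in
/-- The transition map to the section `{ε₁ = ε₁₀}`. The value is meaningful only where an exit
point exists (it is then unique where `X` and `Y` are smooth). -/
noncomputable def transitionMap (X Y : ℝ × ℝ × ℝ → ℝ) (U : Set (ℝ × ℝ × ℝ)) (e₁₀ : ℝ)
    (p : ℝ × ℝ × ℝ) : ℝ × ℝ × ℝ :=
  if h : ∃ q, IsExitPoint X Y U e₁₀ p q then h.choose else p

/-! The product `c = r₁ ε₁` is a first integral, and `r₁` decreases strictly where `r₁ Y > 0`. With
`t = R - r₁` as time, where `R = r₁₀`, the system reduces to the scalar equation `dx/dt = r G(x, r,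
c / r)` with `r = R - t`, `G = X / Y`, the latter cut off to compact support. The transition map
becomes the flow `Φ` of this equation with `c = R ε₁`, stopped at `r = c / ε₁₀`.

The singularity at `r = 0` is harmless. A `c`-derivative costs `1 / r` and an `r`-derivative costs
`c / r²`; the prefactor `r` absorbs the first and leaves `c / r` from the second, which is bounded
on the support of `G`. Hence the field and all its `x`-derivatives are Lipschitz in `(c, t, x)` up
to `c = 0`, `r = 0` (`bddLip_blowupField`). The flow inherits this (`hasDerivAt_flow`,
`Tame.flow_sub`), so every `x`-derivative of the transition map is Lipschitz in `ε₁` on `[0, ε₁₀]`.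
Its value at `ε₁ = 0` is `g₀`, and the remainder is even `O(ε₁)`. -/

/-! ### Closure properties of bounded Lipschitz functions and of their `x`-smooth versions. -/

/-- Functions of `(c, t, x)`, `t ∈ [0, T]`, that are bounded and jointly Lipschitz. -/
def BddLip (T : ℝ) (h : ℝ → ℝ → ℝ → ℝ) : Prop :=
  ∃ K : ℝ, 0 < K ∧ (∀ c x, ∀ t ∈ Icc 0 T, |h c t x| ≤ K) ∧
    ∀ c c' x x', ∀ t ∈ Icc 0 T, ∀ t' ∈ Icc 0 T,
      |h c t x - h c' t' x'| ≤ K * (|c - c'| + |t - t'| + |x - x'|)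

/-- Functions all of whose `x`-derivatives of order at most `k` are bounded and Lipschitz. -/
def Tame (T : ℝ) : ℕ → (ℝ → ℝ → ℝ → ℝ) → Prop
  | 0, h => BddLip T h
  | k + 1, h => BddLip T h ∧ ∃ h' : ℝ → ℝ → ℝ → ℝ,
      (∀ c x, ∀ t ∈ Icc 0 T, HasDerivAt (h c t) (h' c t x) x) ∧ Tame T k h'

variable {T : ℝ} {h g : ℝ → ℝ → ℝ → ℝ}

theorem BddLip.const (a : ℝ) : BddLip T (fun _ _ _ => a) :=
  ⟨|a| + 1, by positivity, fun _ _ _ _ => by linarith, fun _ _ _ _ _ _ _ _ => by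
    rw [sub_self, abs_zero]; positivity⟩

theorem BddLip.add (hh : BddLip T h) (hg : BddLip T g) :
    BddLip T (fun c t x => h c t x + g c t x) := by
  obtain ⟨K, hK, b, l⟩ := hh
  obtain ⟨K', hK', b', l'⟩ := hg
  refine ⟨K + K', by positivity, fun c x t ht => (abs_add_le _ _).trans
    (add_le_add (b c x t ht) (b' c x t ht)), fun c c' x x' t ht t' ht' => ?_⟩
  have h1 := l c c' x x' t ht t' ht'
  have h2 := l' c c' x x' t ht t' ht'
  calc _ = |(h c t x - h c' t' x') + (g c t x - g c' t' x')| := by ring_nf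
    _ ≤ _ := (abs_add_le _ _).trans (by linarith)

theorem BddLip.mul (hh : BddLip T h) (hg : BddLip T g) :
    BddLip T (fun c t x => h c t x * g c t x) := by
  obtain ⟨K, hK, b, l⟩ := hh
  obtain ⟨K', hK', b', l'⟩ := hg
  refine ⟨2 * (K * K'), by positivity, fun c x t ht => ?_, fun c c' x x' t ht t' ht' => ?_⟩
  · rw [abs_mul]
    have := mul_le_mul (b c x t ht) (b' c x t ht) (abs_nonneg _) hK.le
    nlinarith [mul_pos hK hK']
  have h1 := l c c' x x' t ht t' ht'
  have h2 := l' c c' x x' t ht t' ht'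
  calc _ = |(h c t x - h c' t' x') * g c t x + h c' t' x' * (g c t x - g c' t' x')| := by ring_nf
    _ ≤ |h c t x - h c' t' x'| * |g c t x| + |h c' t' x'| * |g c t x - g c' t' x'| := by
      rw [← abs_mul, ← abs_mul]; exact abs_add_le _ _
    _ ≤ (K * (|c - c'| + |t - t'| + |x - x'|)) * K' +
        K * (K' * (|c - c'| + |t - t'| + |x - x'|)) := by
      gcongr
      · exact b' c x t ht
      · exact b c' x' t' ht'
    _ = _ := by ring

theorem BddLip.exp (hh : BddLip T h) : BddLip T (fun c t x => Real.exp (h c t x)) := by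
  obtain ⟨K, hK, b, l⟩ := hh
  have bd : ∀ a b : ℝ, |a| ≤ K → |b| ≤ K → |Real.exp a - Real.exp b| ≤ Real.exp K * |a - b| := by
    intro a b ha hb
    refine (convex_Icc (-K) K).norm_image_sub_le_of_norm_hasDerivWithin_le
      (f' := Real.exp) (fun y _ => (Real.hasDerivAt_exp y).hasDerivWithinAt)
      (fun y hy => ?_) (abs_le.1 hb) (abs_le.1 ha)
    rw [Real.norm_of_nonneg (Real.exp_pos y).le]
    exact Real.exp_le_exp.2 hy.2
  refine ⟨Real.exp K * (K + 1), by positivity, fun c x t ht => ?_, fun c c' x x' t ht t' ht' => ?_⟩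
  · rw [abs_of_pos (Real.exp_pos _)]
    have := Real.exp_le_exp.2 (abs_le.1 (b c x t ht)).2
    nlinarith [Real.exp_pos K]
  · refine (bd _ _ (b c x t ht) (b c' x' t' ht')).trans ?_
    rw [mul_assoc]
    gcongr
    exact (l c c' x x' t ht t' ht').trans (by gcongr; linarith)

theorem BddLip.continuousOn (hh : BddLip T h) (c x : ℝ) :
    ContinuousOn (fun t => h c t x) (Icc 0 T) := by
  obtain ⟨K, hK, -, l⟩ := hh
  refine (LipschitzOnWith.of_dist_le_mul (K := K.toNNReal) fun t ht t' ht' => ?_).continuousOn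
  simpa [Real.dist_eq, hK.le] using l c c x x t ht t' ht'

theorem ContinuousOn.intervalIntegrable_of_mem_Icc {φ : ℝ → ℝ} {a b : ℝ}
    (hφ : ContinuousOn φ (Icc 0 T)) (ha : a ∈ Icc 0 T) (hb : b ∈ Icc 0 T) :
    IntervalIntegrable φ MeasureTheory.volume a b :=
  (hφ.mono (ordConnected_Icc.uIcc_subset ha hb)).intervalIntegrable

theorem BddLip.integral (hh : BddLip T h) : BddLip T (fun c t x => ∫ s in 0..t, h c s x) := by
  obtain ⟨K, hK, b, l⟩ := id hh
  rcases lt_or_ge T 0 with hT | hT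
  · exact ⟨1, one_pos, fun c x t ht => absurd (ht.1.trans ht.2) hT.not_ge,
      fun c c' x x' t ht => absurd (ht.1.trans ht.2) hT.not_ge⟩
  have h0 : (0 : ℝ) ∈ Icc 0 T := ⟨le_rfl, hT⟩
  have bint : ∀ c x, ∀ t ∈ Icc 0 T, ∀ t' ∈ Icc 0 T, |∫ s in t'..t, h c s x| ≤ K * |t - t'| := by
    intro c x t ht t' ht'
    rw [← Real.norm_eq_abs]
    refine intervalIntegral.norm_integral_le_of_norm_le_const (fun s hs => ?_)
    refine b c x s ?_
    exact ordConnected_Icc.uIcc_subset ht' ht (uIoc_subset_uIcc hs)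
  refine ⟨K * (T + 1), by positivity, fun c x t ht => ?_, fun c c' x x' t ht t' ht' => ?_⟩
  · refine (bint c x t ht 0 h0).trans ?_
    rw [sub_zero, abs_of_nonneg ht.1]
    gcongr
    linarith [ht.2]
  · have i1 := (hh.continuousOn c x).intervalIntegrable_of_mem_Icc h0 ht
    have i2 := (hh.continuousOn c x).intervalIntegrable_of_mem_Icc h0 ht'
    have i3 := (hh.continuousOn c' x').intervalIntegrable_of_mem_Icc h0 ht'
    have e1 : (∫ s in 0..t, h c s x) - ∫ s in 0..t', h c' s x' =
        (∫ s in t'..t, h c s x) + ∫ s in 0..t', (h c s x - h c' s x') := by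
      rw [intervalIntegral.integral_sub i2 i3, ← intervalIntegral.integral_interval_sub_left i1 i2]
      ring
    have e2 : |∫ s in 0..t', (h c s x - h c' s x')| ≤
        (K * (|c - c'| + |x - x'|)) * |t' - 0| := by
      rw [← Real.norm_eq_abs]
      refine intervalIntegral.norm_integral_le_of_norm_le_const (fun s hs => ?_)
      have hs' := ordConnected_Icc.uIcc_subset h0 ht' (uIoc_subset_uIcc hs)
      simpa using l c c' x x' s hs' s hs'
    rw [e1]
    refine (abs_add_le _ _).trans ((add_le_add (bint c x t ht t' ht') e2).trans ?_)
    rw [sub_zero, abs_of_nonneg ht'.1]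
    have : K * (|c - c'| + |x - x'|) * t' ≤ K * (|c - c'| + |x - x'|) * T := by
      gcongr; exact ht'.2
    nlinarith [mul_nonneg hK.le (abs_nonneg (c - c')), mul_nonneg hK.le (abs_nonneg (x - x')),
      mul_nonneg (mul_nonneg hK.le (abs_nonneg (t - t'))) hT]

theorem Tame.bddLip {k : ℕ} (hh : Tame T k h) : BddLip T h := by
  cases k with
  | zero => exact hh
  | succ k => exact hh.1

theorem Tame.of_succ {k : ℕ} (hh : Tame T (k + 1) h) : Tame T k h := by
  induction k generalizing h with
  | zero => exact hh.1
  | succ k ih =>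
    obtain ⟨b, h', d, t⟩ := hh
    exact ⟨b, h', d, ih t⟩

theorem Tame.const (k : ℕ) (a : ℝ) : Tame T k (fun _ _ _ => a) := by
  induction k generalizing a with
  | zero => exact BddLip.const a
  | succ k ih => exact ⟨BddLip.const a, _, fun c x t _ => hasDerivAt_const x a, ih 0⟩

theorem Tame.add {k : ℕ} (hh : Tame T k h) (hg : Tame T k g) :
    Tame T k (fun c t x => h c t x + g c t x) := by
  induction k generalizing h g with
  | zero => exact BddLip.add hh hg
  | succ k ih =>
    obtain ⟨b, h', d, t⟩ := hh
    obtain ⟨b', g', d', t'⟩ := hg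
    exact ⟨b.add b', _, fun c x t ht => (d c x t ht).add (d' c x t ht), ih t t'⟩

theorem Tame.mul {k : ℕ} (hh : Tame T k h) (hg : Tame T k g) :
    Tame T k (fun c t x => h c t x * g c t x) := by
  induction k generalizing h g with
  | zero => exact BddLip.mul hh hg
  | succ k ih =>
    obtain ⟨b, h', d, t⟩ := id hh
    obtain ⟨b', g', d', t'⟩ := id hg
    exact ⟨b.mul b', _, fun c x t ht => (d c x t ht).mul (d' c x t ht),
      (ih t hg.of_succ).add (ih hh.of_succ t')⟩

theorem Tame.exp {k : ℕ} (hh : Tame T k h) : Tame T k (fun c t x => Real.exp (h c t x)) := by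
  induction k generalizing h with
  | zero => exact BddLip.exp hh
  | succ k ih =>
    obtain ⟨b, h', d, t⟩ := id hh
    exact ⟨b.exp, _, fun c x t ht => (d c x t ht).exp, (ih hh.of_succ).mul t⟩

theorem Tame.integral {k : ℕ} (hh : Tame T k h) : Tame T k (fun c t x => ∫ s in 0..t, h c s x) := by
  induction k generalizing h with
  | zero => exact BddLip.integral hh
  | succ k ih =>
    obtain ⟨b, h', d, hh'⟩ := id hh
    refine ⟨b.integral, _, fun c x t ht => ?_, ih hh'⟩
    obtain ⟨K, hK, b', -⟩ := hh'.bddLip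
    have h0 : (0 : ℝ) ∈ Icc 0 T := ⟨le_rfl, ht.1.trans ht.2⟩
    have sub : ∀ s ∈ uIoc 0 t, s ∈ Icc 0 T := fun s hs =>
      ordConnected_Icc.uIcc_subset h0 ht (uIoc_subset_uIcc hs)
    refine (intervalIntegral.hasDerivAt_integral_of_dominated_loc_of_deriv_le
      (F := fun x s => h c s x) (F' := fun x s => h' c s x) (bound := fun _ => K) univ_mem
      (Eventually.of_forall fun y =>
        ((b.continuousOn c y).intervalIntegrable_of_mem_Icc h0 ht).def'.aestronglyMeasurable)
      ((b.continuousOn c x).intervalIntegrable_of_mem_Icc h0 ht)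
      (((hh'.bddLip.continuousOn c x).intervalIntegrable_of_mem_Icc h0 ht).def'.aestronglyMeasurable)
      (Eventually.of_forall fun s hs y _ => b' c y s (sub s hs))
      intervalIntegrable_const
      (Eventually.of_forall fun s hs y _ => d c y s (sub s hs))).2

theorem Tame.contDiff {k : ℕ} (hh : Tame T k h) (c : ℝ) {t : ℝ} (ht : t ∈ Icc 0 T) :
    ContDiff ℝ k (h c t) := by
  induction k generalizing h with
  | zero =>
    obtain ⟨K, hK, -, l⟩ := hh
    refine contDiff_zero.2 (LipschitzWith.of_dist_le_mul (K := K.toNNReal) fun x x' => ?_).continuous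
    simpa [Real.dist_eq, hK.le] using l c c x x' t ht t ht
  | succ k ih =>
    obtain ⟨b, h', d, t'⟩ := hh
    have : deriv (h c t) = h' c t := funext fun x => (d c x t ht).deriv
    push_cast
    rw [contDiff_succ_iff_deriv, this]
    exact ⟨fun x => (d c x t ht).differentiableAt, by simp, ih t'⟩

theorem Tame.bddLip_iteratedDeriv {k : ℕ} (hh : Tame T k h) :
    BddLip T (fun c t x => iteratedDeriv k (h c t) x) := by
  induction k generalizing h with
  | zero => simpa only [iteratedDeriv_zero] using! hh
  | succ k ih =>
    obtain ⟨b, h', d, t'⟩ := hh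
    obtain ⟨K, hK, b, l⟩ := ih t'
    have : ∀ c, ∀ t ∈ Icc 0 T, deriv (h c t) = h' c t :=
      fun c t ht => funext fun x => (d c x t ht).deriv
    refine ⟨K, hK, fun c x t ht => ?_, fun c c' x x' t ht t' ht' => ?_⟩
    · beta_reduce; rw [iteratedDeriv_succ', this c t ht]; exact b c x t ht
    · beta_reduce; rw [iteratedDeriv_succ', iteratedDeriv_succ', this c t ht, this c' t' ht']
      exact l c c' x x' t ht t' ht'

/-! ### Scalar flows: existence, Lipschitz dependence, `x`-derivatives of every order. -/

theorem BddLip.exists_flow {f : ℝ → ℝ → ℝ → ℝ} (hf : BddLip T f) (hT : 0 ≤ T) :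
    ∃ Φ : ℝ → ℝ → ℝ → ℝ, ∀ c x, Φ c 0 x = x ∧ ∀ t ∈ Icc 0 T,
      HasDerivWithinAt (fun s => Φ c s x) (f c t (Φ c t x)) (Icc 0 T) t := by
  obtain ⟨K, hK, b, l⟩ := id hf
  have key : ∀ c x, ∃ α : ℝ → ℝ, α 0 = x ∧ ∀ t ∈ Icc 0 T,
      HasDerivWithinAt α (f c t (α t)) (Icc 0 T) t := by
    intro c x
    -- Since `|f| ≤ K` globally, the ball of radius `K T` is never left, so one application covers
    -- all of `[0, T]`.
    have pl : IsPicardLindelof (f c) (⟨0, le_rfl, hT⟩ : Icc 0 T) x (K * T).toNNReal 0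
        K.toNNReal K.toNNReal := by
      refine ⟨fun t ht => LipschitzOnWith.of_dist_le_mul fun y _ y' _ => ?_,
        fun y _ => hf.continuousOn c y, fun t ht y _ => ?_, ?_⟩
      · simpa [Real.dist_eq, hK.le] using l c c y y' t ht t ht
      · simpa [hK.le] using b c y t ht
      · simp [hK.le, hT, mul_nonneg]
    exact pl.exists_eq_forall_mem_Icc_hasDerivWithinAt₀
  choose Φ h0 h1 using key
  exact ⟨fun c t x => Φ c x t, fun c x => ⟨h0 c x, h1 c x⟩⟩

theorem hasDerivAt_of_abs_sub_le_sq {F : ℝ → ℝ} {a x C : ℝ}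
    (hF : ∀ y, |F y - F x - (y - x) * a| ≤ C * (y - x) ^ 2) : HasDerivAt F a x := by
  rw [hasDerivAt_iff_isLittleO]
  have h1 : (fun y => F y - F x - (y - x) • a) =O[𝓝 x] fun y => (y - x) ^ 2 :=
    Asymptotics.IsBigO.of_bound C (Eventually.of_forall fun y => by
      simpa [abs_of_nonneg, sq_nonneg] using hF y)
  refine h1.trans_isLittleO ?_
  have h2 : Tendsto (fun y => y - x) (𝓝 x) (𝓝 0) := by
    simpa using (continuous_id.sub continuous_const).tendsto (f := fun y : ℝ => y - x) x
  simpa using! (Asymptotics.isLittleO_pow_id (𝕜 := ℝ) one_lt_two).comp_tendsto h2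

theorem abs_sub_sub_mul_le_of_lipschitz_deriv {F F' : ℝ → ℝ} {K : ℝ} (hK : 0 ≤ K)
    (hF : ∀ y, HasDerivAt F (F' y) y) (hF' : ∀ y z, |F' y - F' z| ≤ K * |y - z|) (a b : ℝ) :
    |F b - F a - F' a * (b - a)| ≤ K * (b - a) ^ 2 := by
  have := (convex_uIcc a b).norm_image_sub_le_of_norm_hasDerivWithin_le
    (f := fun y => F y - F' a * y) (f' := fun y => F' y - F' a) (C := K * |b - a|)
    (fun y _ => by
      simpa using! ((hF y).sub ((hasDerivAt_id y).const_mul (F' a))).hasDerivWithinAt)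
    (fun y hy => (hF' y a).trans (by gcongr 1; exact abs_sub_left_of_mem_uIcc hy))
    left_mem_uIcc right_mem_uIcc
  rw [Real.norm_eq_abs, Real.norm_eq_abs, mul_assoc, abs_mul_abs_self] at this
  calc _ = |F b - F' a * b - (F a - F' a * a)| := by ring_nf
    _ ≤ _ := this.trans_eq (by ring)

/-- The displacement of the flow of a bounded Lipschitz field is bounded and Lipschitz. -/
theorem BddLip.flow_sub {f Φ : ℝ → ℝ → ℝ → ℝ} (hf : BddLip T f)
    (hΦ : ∀ c x, Φ c 0 x = x ∧ ∀ t ∈ Icc 0 T,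
      HasDerivWithinAt (fun s => Φ c s x) (f c t (Φ c t x)) (Icc 0 T) t) :
    BddLip T (fun c t x => Φ c t x - x) := by
  obtain ⟨K, hK, b, l⟩ := hf
  rcases lt_or_ge T 0 with hT | hT
  · exact ⟨1, one_pos, fun c x t ht => absurd (ht.1.trans ht.2) hT.not_ge,
      fun c c' x x' t ht => absurd (ht.1.trans ht.2) hT.not_ge⟩
  have ht : ∀ c x, ∀ t ∈ Icc 0 T, ∀ t' ∈ Icc 0 T, |Φ c t x - Φ c t' x| ≤ K * |t - t'| :=
    fun c x t ht t' ht' => (convex_Icc 0 T).norm_image_sub_le_of_norm_hasDerivWithin_le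
      (hΦ c x).2 (fun s hs => b c _ s hs) ht' ht
  have hx : ∀ c c' x x', ∀ t ∈ Icc 0 T, |Φ c t x - Φ c' t x'| ≤
      Real.exp (K * T) * (|c - c'| + |x - x'|) := by
    intro c c' x x' t ht
    have hd : ∀ s ∈ Icc 0 T, HasDerivWithinAt (fun s => Φ c s x - Φ c' s x')
        (f c s (Φ c s x) - f c' s (Φ c' s x')) (Icc 0 T) s :=
      fun s hs => ((hΦ c x).2 s hs).sub ((hΦ c' x').2 s hs)
    -- The change of parameter enters Grönwall as a constant forcing `K |c - c'|`, the change of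
    -- initial point as the initial error.
    have := norm_le_gronwallBound_of_norm_deriv_right_le (δ := |x - x'|) (K := K)
      (ε := K * |c - c'|) (fun s hs => (hd s hs).continuousWithinAt)
      (fun s hs => (hd s (Ico_subset_Icc_self hs)).mono_of_mem_nhdsWithin
        (mem_of_superset (Icc_mem_nhdsGE hs.2) (Icc_subset_Icc_left hs.1)))
      (by simp [(hΦ _ _).1]) (fun s hs => by
        have hs := Ico_subset_Icc_self hs
        refine (l c c' (Φ c s x) (Φ c' s x') s hs s hs).trans_eq ?_
        rw [sub_self, abs_zero, Real.norm_eq_abs]; ring) t ht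
    refine this.trans ?_
    rw [gronwallBound_of_K_ne_0 hK.ne', sub_zero, mul_div_cancel_left₀ _ hK.ne']
    have e : Real.exp (K * t) ≤ Real.exp (K * T) := by gcongr; exact ht.2
    nlinarith [abs_nonneg (c - c'), abs_nonneg (x - x'), mul_le_mul_of_nonneg_left e
      (abs_nonneg (c - c')), mul_le_mul_of_nonneg_left e (abs_nonneg (x - x'))]
  refine ⟨K * (T + 1) + Real.exp (K * T) + 1, by positivity, fun c x t ht' => ?_,
    fun c c' x x' t ht1 t' ht2 => ?_⟩
  · have := ht c x t ht' 0 ⟨le_rfl, hT⟩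
    rw [(hΦ c x).1, sub_zero, abs_of_nonneg ht'.1] at this
    nlinarith [Real.exp_pos (K * T), mul_le_mul_of_nonneg_left ht'.2 hK.le]
  · calc _ = |(Φ c t x - Φ c t' x) + (Φ c t' x - Φ c' t' x') + (x' - x)| := by ring_nf
      _ ≤ K * |t - t'| + Real.exp (K * T) * (|c - c'| + |x - x'|) + |x - x'| := by
        refine (abs_add_le _ _).trans (add_le_add ((abs_add_le _ _).trans
          (add_le_add (ht c x t ht1 t' ht2) (hx c c' x x' t' ht2))) (abs_sub_comm _ _).le)
      _ ≤ _ := by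
        have := mul_nonneg hK.le hT
        have := Real.exp_pos (K * T)
        nlinarith [abs_nonneg (c - c'), abs_nonneg (x - x'), abs_nonneg (t - t'),
          mul_nonneg (mul_nonneg hK.le hT) (abs_nonneg (t - t')),
          mul_nonneg (mul_nonneg hK.le hT) (abs_nonneg (c - c')),
          mul_nonneg (mul_nonneg hK.le hT) (abs_nonneg (x - x')),
          mul_nonneg hK.le (abs_nonneg (c - c')), mul_nonneg hK.le (abs_nonneg (x - x')),
          mul_nonneg this.le (abs_nonneg (t - t'))]

/-- The flow itself is unbounded in `x`, so the hypothesis concerns its displacement; boundedness of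
the composite comes from `g`. -/
theorem BddLip.comp_flow {g Φ : ℝ → ℝ → ℝ → ℝ} (hg : BddLip T g)
    (hΦ : BddLip T (fun c t x => Φ c t x - x)) : BddLip T (fun c t x => g c t (Φ c t x)) := by
  obtain ⟨K, hK, b, l⟩ := hg
  obtain ⟨K', hK', -, l'⟩ := hΦ
  refine ⟨K * (K' + 2), by positivity, fun c x t ht => (b c _ t ht).trans (by nlinarith),
    fun c c' x x' t ht t' ht' => (l c c' _ _ t ht t' ht').trans ?_⟩
  rw [mul_assoc]
  gcongr
  have h1 := l' c c' x x' t ht t' ht'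
  have h2 : |Φ c t x - Φ c' t' x'| ≤ |Φ c t x - x - (Φ c' t' x' - x')| + |x - x'| := by
    refine le_trans (le_of_eq ?_) (abs_add_le _ _); ring_nf
  nlinarith [abs_nonneg (c - c'), abs_nonneg (x - x'), abs_nonneg (t - t')]

theorem BddLip.hasDerivWithinAt_integral (hh : BddLip T h) (c x : ℝ) {t : ℝ} (ht : t ∈ Icc 0 T) :
    HasDerivWithinAt (fun t => ∫ s in 0..t, h c s x) (h c t x) (Icc 0 T) t := by
  have hc := hh.continuousOn c x
  have h0 : (0 : ℝ) ∈ Icc 0 T := ⟨le_rfl, ht.1.trans ht.2⟩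
  have : Fact (t ∈ Icc 0 T) := ⟨ht⟩
  exact intervalIntegral.integral_hasDerivWithinAt_right (hc.intervalIntegrable_of_mem_Icc h0 ht)
    (hc.stronglyMeasurableAtFilter_nhdsWithin measurableSet_Icc t) (hc t ht)

/-- The `x`-derivative of the flow solves the linearized equation. -/
theorem hasDerivAt_flow {f f' Φ : ℝ → ℝ → ℝ → ℝ} (hf : BddLip T f) (hf' : BddLip T f')
    (hd : ∀ c x, ∀ t ∈ Icc 0 T, HasDerivAt (f c t) (f' c t x) x)
    (hΦ : ∀ c x, Φ c 0 x = x ∧ ∀ t ∈ Icc 0 T,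
      HasDerivWithinAt (fun s => Φ c s x) (f c t (Φ c t x)) (Icc 0 T) t)
    (c x : ℝ) {t : ℝ} (ht : t ∈ Icc 0 T) :
    HasDerivAt (Φ c t) (Real.exp (∫ s in 0..t, f' c s (Φ c s x))) x := by
  have hu := hf.flow_sub hΦ
  obtain ⟨L, hL, -, lL⟩ := id hu
  obtain ⟨K, hK, -, l⟩ := id hf'
  have hcomp := hf'.comp_flow hu
  obtain ⟨E, hE, bE, -⟩ := hcomp.integral
  set w : ℝ → ℝ := fun t => ∫ s in 0..t, f' c s (Φ c s x)
  have hw : ∀ s ∈ Icc 0 T, HasDerivWithinAt w (f' c s (Φ c s x)) (Icc 0 T) s :=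
    fun s hs => hcomp.hasDerivWithinAt_integral c x hs
  have hw0 : w 0 = 0 := by simp [w]
  have h0 : (0 : ℝ) ∈ Icc 0 T := ⟨le_rfl, ht.1.trans ht.2⟩
  -- The two factors `exp E` bound `exp (w t)` and `exp (-w s)`; `K` comes from the Taylor remainder
  -- of `f` and `L + 1` is the Lipschitz constant of the flow in `x`.
  refine hasDerivAt_of_abs_sub_le_sq
    (C := Real.exp E * (Real.exp E * (K * (L + 1) ^ 2) * T)) fun y => ?_
  -- The integrating factor `exp (-w)` removes the linear part of the equation for the difference of
  -- two solutions; only the second-order Taylor remainder is left.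
  have hz : ∀ s ∈ Icc 0 T, HasDerivWithinAt (fun s => (Φ c s y - Φ c s x) * Real.exp (-w s))
      (Real.exp (-w s) * (f c s (Φ c s y) - f c s (Φ c s x) -
        f' c s (Φ c s x) * (Φ c s y - Φ c s x))) (Icc 0 T) s := fun s hs => by
    refine ((((hΦ c y).2 s hs).sub ((hΦ c x).2 s hs)).mul (hw s hs).neg.exp).congr_deriv ?_
    simp only [Pi.sub_apply, Pi.neg_apply]; ring
  have hb : ∀ s ∈ Icc 0 T, ‖Real.exp (-w s) * (f c s (Φ c s y) - f c s (Φ c s x) -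
      f' c s (Φ c s x) * (Φ c s y - Φ c s x))‖ ≤
      Real.exp E * (K * (L + 1) ^ 2) * (y - x) ^ 2 := by
    intro s hs
    rw [norm_mul, Real.norm_of_nonneg (Real.exp_pos _).le, Real.norm_eq_abs, mul_assoc]
    have e1 := abs_sub_sub_mul_le_of_lipschitz_deriv hK.le (fun y => hd c y s hs)
      (fun y z => by simpa using l c c y z s hs s hs) (Φ c s x) (Φ c s y)
    have e2 : |Φ c s y - Φ c s x| ≤ (L + 1) * |y - x| := by
      have := lL c c y x s hs s hs
      simp only [sub_self, abs_zero, zero_add] at this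
      calc _ = |(Φ c s y - y - (Φ c s x - x)) + (y - x)| := by ring_nf
        _ ≤ _ := (abs_add_le _ _).trans (by linarith)
    have e3 : (Φ c s y - Φ c s x) ^ 2 ≤ (L + 1) ^ 2 * (y - x) ^ 2 := by
      rw [← mul_pow, sq_le_sq, abs_mul, abs_of_pos (by positivity : (0 : ℝ) < L + 1)]
      exact e2
    have e4 : -w s ≤ E := by linarith [(abs_le.1 (bE c x s hs)).1]
    gcongr
    exact e1.trans ((mul_le_mul_of_nonneg_left e3 hK.le).trans_eq (by ring))
  have hmv := (convex_Icc 0 T).norm_image_sub_le_of_norm_hasDerivWithin_le hz hb h0 ht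
  simp only [(hΦ c _).1, hw0, neg_zero, Real.exp_zero, mul_one, sub_zero] at hmv
  rw [Real.norm_eq_abs, Real.norm_eq_abs, abs_of_nonneg ht.1] at hmv
  have e : Φ c t y - Φ c t x - (y - x) * Real.exp (w t) =
      Real.exp (w t) * ((Φ c t y - Φ c t x) * Real.exp (-w t) - (y - x)) := by
    have : Real.exp (w t) * Real.exp (-w t) = 1 := by rw [← Real.exp_add]; simp
    linear_combination -(Φ c t y - Φ c t x) * this
  rw [e, abs_mul, abs_of_pos (Real.exp_pos _), mul_assoc]
  have e5 : w t ≤ E := (abs_le.1 (bE c x t ht)).2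
  gcongr
  refine hmv.trans ?_
  rw [mul_assoc, mul_assoc _ T, mul_comm T]
  gcongr
  exact ht.2

/-- Here `D j` is the `j`-th `x`-derivative of `D 0`. The chain rule raises `j` by one while
lowering `k`, so the induction on `k` must run over all `j` at once. -/
theorem Tame.comp_flow {D : ℕ → ℝ → ℝ → ℝ → ℝ} (hD : ∀ j, BddLip T (D j))
    (hd : ∀ j c x, ∀ t ∈ Icc 0 T, HasDerivAt (D j c t) (D (j + 1) c t x) x)
    {Φ : ℝ → ℝ → ℝ → ℝ} {k : ℕ} (hΦ : Tame T k (fun c t x => Φ c t x - x)) (j : ℕ) :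
    Tame T k (fun c t x => D j c t (Φ c t x)) := by
  induction k generalizing j with
  | zero => exact (hD j).comp_flow hΦ
  | succ k ih =>
    refine ⟨(hD j).comp_flow hΦ.bddLip, ?_⟩
    obtain ⟨-, u', du, hu'⟩ := id hΦ
    refine ⟨_, fun c x t ht => ?_, (ih hΦ.of_succ (j + 1)).mul (hu'.add (Tame.const k 1))⟩
    have : HasDerivAt (Φ c t) (u' c t x + 1) x := by
      refine ((du c x t ht).add (hasDerivAt_id x)).congr_of_eventuallyEq
        (Eventually.of_forall fun y => ?_)
      simp
    exact (hd j c (Φ c t x) t ht).comp x this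

/-- Bootstrap: the `x`-derivative of the flow is the exponential of an integral of `D 1` along the
flow, so control to order `k` gives control to order `k + 1`. -/
theorem Tame.flow_sub {D : ℕ → ℝ → ℝ → ℝ → ℝ} (hD : ∀ j, BddLip T (D j))
    (hd : ∀ j c x, ∀ t ∈ Icc 0 T, HasDerivAt (D j c t) (D (j + 1) c t x) x)
    {Φ : ℝ → ℝ → ℝ → ℝ} (hΦ : ∀ c x, Φ c 0 x = x ∧ ∀ t ∈ Icc 0 T,
      HasDerivWithinAt (fun s => Φ c s x) (D 0 c t (Φ c t x)) (Icc 0 T) t) (k : ℕ) :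
    Tame T k (fun c t x => Φ c t x - x) := by
  induction k with
  | zero => exact (hD 0).flow_sub hΦ
  | succ k ih =>
    refine ⟨(hD 0).flow_sub hΦ, _, fun c x t ht => ?_,
      ((Tame.comp_flow hD hd ih 1).integral.exp).add (Tame.const k (-1))⟩
    simpa [sub_eq_add_neg] using!
      (hasDerivAt_flow (hD 0) (hD 1) (hd 0) hΦ c x ht).sub (hasDerivAt_id x)

/-! ### The reduced equation and its regularity at `r = 0`. -/

/-- The field `x' = r G(x, r, c / r)`, in the variable `t = R - r`. -/
noncomputable def blowupField (R : ℝ) (G : ℝ × ℝ × ℝ → ℝ) (c t x : ℝ) : ℝ :=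
  (R - t) * G (x, R - t, c / (R - t))

theorem bddLip_blowupField {R : ℝ} {G : ℝ × ℝ × ℝ → ℝ} (hG : ContDiff ℝ ∞ G)
    (hs : HasCompactSupport G) : BddLip R (blowupField R G) := by
  obtain ⟨B, hB⟩ := hs.exists_bound_of_continuous hG.continuous
  obtain ⟨L, hL⟩ := hG.lipschitzWith_of_hasCompactSupport hs (by simp)
  obtain ⟨E, hE0, hE⟩ : ∃ E : ℝ, 0 < E ∧ ∀ p : ℝ × ℝ × ℝ, E < |p.2.2| → G p = 0 := by
    obtain ⟨E, hE0, hE⟩ := hs.isCompact.isBounded.exists_pos_norm_le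
    refine ⟨E, hE0, fun p hp => by_contra fun h => ?_⟩
    have h1 := hE p (subset_tsupport _ h)
    have h2 : |p.2.2| ≤ ‖p‖ := (norm_snd_le p.2).trans (norm_snd_le p)
    linarith
  have hB0 : 0 ≤ B := (norm_nonneg _).trans (hB 0)
  have hL' : ∀ x r e x' r' e', |G (x, r, e) - G (x', r', e')| ≤
      L * (|x - x'| + |r - r'| + |e - e'|) := by
    intro x r e x' r' e'
    refine (hL.dist_le_mul (x, r, e) (x', r', e')).trans ?_
    gcongr
    simp only [Prod.dist_eq, Real.dist_eq]
    refine max_le (by linarith [abs_nonneg (r - r'), abs_nonneg (e - e')]) (max_le ?_ ?_) <;>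
      linarith [abs_nonneg (r - r'), abs_nonneg (e - e'), abs_nonneg (x - x')]
  -- Fixed `r`: the prefactor `r` cancels the `1 / r` in `c / r - c' / r`. At `r = 0` it also makes
  -- the value of `c / 0` irrelevant.
  have hA : ∀ r ∈ Icc 0 R, ∀ c c' x x', |r * G (x, r, c / r) - r * G (x', r, c' / r)| ≤
      L * (R * |x - x'| + |c - c'|) := by
    intro r hr c c' x x'
    rcases hr.1.eq_or_lt with rfl | h0
    · simp only [zero_mul, sub_self, abs_zero]
      have := hr.2
      positivity
    rw [← mul_sub, abs_mul, abs_of_pos h0]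
    calc _ ≤ r * (L * (|x - x'| + |r - r| + |c / r - c' / r|)) := by gcongr; apply hL'
      _ = L * (r * |x - x'| + |c - c'|) := by
        rw [← sub_div, abs_div, abs_of_pos h0, sub_self, abs_zero]; field_simp; ring
      _ ≤ _ := by gcongr; exact hr.2
  have hC : ∀ r ∈ Icc 0 R, ∀ r' ∈ Icc 0 R, r ≤ r' → ∀ c x,
      |r * G (x, r, c / r) - r' * G (x, r', c / r')| ≤ (L * (R + E) + B) * |r - r'| := by
    intro r hr r' hr' hrr c x
    have hR : 0 ≤ R := hr.1.trans hr.2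
    have hfirst : |r * (G (x, r, c / r) - G (x, r', c / r'))| ≤ L * (R + E) * |r - r'| := by
      rcases hr.1.eq_or_lt with rfl | h0
      · rw [zero_mul, abs_zero]; positivity
      have h0' : 0 < r' := h0.trans_le hrr
      by_cases hc : E < |c / r'|
      · have hc' : E < |c / r| := hc.trans_le (by
          rw [abs_div, abs_div, abs_of_pos h0, abs_of_pos h0']; gcongr)
        rw [hE (x, r, c / r) hc', hE (x, r', c / r') hc, sub_self, mul_zero, abs_zero]
        positivity
      rw [abs_mul, abs_of_pos h0]
      calc _ ≤ r * (L * (|x - x| + |r - r'| + |c / r - c / r'|)) := by gcongr; apply hL'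
        _ = L * (r * |r - r'| + |c / r'| * |r - r'|) := by
          have : c / r - c / r' = -(c / r' * (r - r') / r) := by field_simp; ring
          rw [this, abs_neg, abs_div, abs_mul, abs_of_pos h0, sub_self, abs_zero]
          field_simp; ring
        _ ≤ L * (R * |r - r'| + E * |r - r'|) := by
          gcongr
          · exact hr.2
          · exact not_lt.1 hc
        _ = _ := by ring
    calc _ = |r * (G (x, r, c / r) - G (x, r', c / r')) + (r - r') * G (x, r', c / r')| := by
          ring_nf
      _ ≤ _ := abs_add_le _ _
      _ ≤ L * (R + E) * |r - r'| + |r - r'| * B := by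
          rw [abs_mul (r - r')]; gcongr; exact hB _
      _ = _ := by ring
  rcases lt_or_ge R 0 with hR | hR
  · exact ⟨1, one_pos, fun c x t ht => absurd (ht.1.trans ht.2) hR.not_ge,
      fun c c' x x' t ht => absurd (ht.1.trans ht.2) hR.not_ge⟩
  have hmem : ∀ t ∈ Icc 0 R, R - t ∈ Icc 0 R := fun t ht => ⟨by linarith [ht.2], by linarith [ht.1]⟩
  refine ⟨R * B + (L * (R + E) + B) + L * R + L + 1, by positivity, fun c x t ht => ?_,
    fun c c' x x' t ht t' ht' => ?_⟩
  · rw [blowupField, abs_mul, abs_of_nonneg (hmem t ht).1]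
    calc _ ≤ R * B := by
          gcongr
          exacts [(hmem t ht).2, hB _]
      _ ≤ _ := by
          have : 0 ≤ (L * (R + E) + B) + L * R + L + 1 := by positivity
          linarith
  · have hC' : |(R - t) * G (x', R - t, c' / (R - t)) - (R - t') * G (x', R - t', c' / (R - t'))| ≤
        (L * (R + E) + B) * |t - t'| := by
      have e : |t - t'| = |(R - t) - (R - t')| := by rw [abs_sub_comm]; ring_nf
      rw [e]
      rcases le_total (R - t) (R - t') with hle | hle
      · exact hC _ (hmem t ht) _ (hmem t' ht') hle c' x'
      · rw [abs_sub_comm, abs_sub_comm (R - t)]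
        exact hC _ (hmem t' ht') _ (hmem t ht) hle c' x'
    have hA' := hA _ (hmem t ht) c c' x x'
    refine (abs_sub_le _ ((R - t) * G (x', R - t, c' / (R - t))) _).trans
      ((add_le_add hA' hC').trans ?_)
    have q1 := abs_nonneg (c - c')
    have q2 := abs_nonneg (t - t')
    have q3 := abs_nonneg (x - x')
    have p1 : 0 ≤ R * B := by positivity
    have p2 : 0 ≤ L * (R + E) + B := by positivity
    have p3 : 0 ≤ L * R := by positivity
    have p4 : (0 : ℝ) ≤ L := L.2
    nlinarith [mul_nonneg p1 q1, mul_nonneg p1 q2, mul_nonneg p1 q3, mul_nonneg p2 q1,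
      mul_nonneg p2 q3, mul_nonneg p3 q1, mul_nonneg p3 q2, mul_nonneg p4 q2, mul_nonneg p4 q3]

/-- The iterated partial derivative in the first variable. -/
noncomputable def partialX (G : ℝ × ℝ × ℝ → ℝ) : ℕ → ℝ × ℝ × ℝ → ℝ
  | 0 => G
  | j + 1 => fun p => fderiv ℝ (partialX G j) p (1, 0, 0)

theorem partialX_contDiff_hasCompactSupport {G : ℝ × ℝ × ℝ → ℝ} (hG : ContDiff ℝ ∞ G)
    (hs : HasCompactSupport G) (j : ℕ) :
    ContDiff ℝ ∞ (partialX G j) ∧ HasCompactSupport (partialX G j) := by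
  induction j with
  | zero => exact ⟨hG, hs⟩
  | succ j ih =>
    exact ⟨(ih.1.fderiv_right (m := ∞) (by simp)).clm_apply contDiff_const,
      ih.2.fderiv_apply ℝ (1, 0, 0)⟩

/-- The flow of `blowupField` together with the regularity of its displacement. -/
theorem exists_blowup_flow {R : ℝ} (hR : 0 ≤ R) {G : ℝ × ℝ × ℝ → ℝ} (hG : ContDiff ℝ ∞ G)
    (hs : HasCompactSupport G) : ∃ Φ : ℝ → ℝ → ℝ → ℝ,
      (∀ c x, Φ c 0 x = x ∧ ∀ t ∈ Icc 0 R,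
        HasDerivWithinAt (fun s => Φ c s x) (blowupField R G c t (Φ c t x)) (Icc 0 R) t) ∧
      ∀ k, Tame R k (fun c t x => Φ c t x - x) := by
  have hp := partialX_contDiff_hasCompactSupport hG hs
  -- Differentiating in `x` leaves the factor `r` and the argument `c / r` untouched, so each
  -- derivative is again a field of the same type.
  have hD : ∀ j, BddLip R (blowupField R (partialX G j)) :=
    fun j => bddLip_blowupField (hp j).1 (hp j).2
  obtain ⟨Φ, hΦ⟩ := (hD 0).exists_flow hR
  refine ⟨Φ, hΦ, Tame.flow_sub hD (fun j c x t _ => ?_) hΦ⟩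
  refine HasDerivAt.const_mul (R - t) ?_
  exact ((((hp j).1.differentiable (by simp)) _).hasFDerivAt).comp_hasDerivAt x
    ((hasDerivAt_id x).prodMk ((hasDerivAt_const x (R - t)).prodMk
      (hasDerivAt_const x (c / (R - t)))))

/-! ### From the reduced equation back to the original system. -/

/-- Traversing `[0, b]` at the positive speed `v` takes finite time. -/
theorem exists_time_change {v : ℝ → ℝ} {b : ℝ} (hb : 0 ≤ b) (hv : ContinuousOn v (Icc 0 b))
    (hpos : ∀ t ∈ Icc 0 b, 0 < v t) : ∃ S : ℝ, 0 ≤ S ∧ ∃ σ : ℝ → ℝ, σ 0 = 0 ∧ σ S = b ∧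
      ∀ τ ∈ Icc 0 S, σ τ ∈ Icc 0 b ∧ HasDerivAt σ (v (σ τ)) τ ∧ (τ < S → σ τ < b) := by
  -- The time change inverts `S(t) = ∫ 1 / v`. Extending `1 / v` by constants makes `S` a bijection
  -- of `ℝ`, so its inverse has two-sided derivatives even at the endpoints.
  set y : ℝ → ℝ := IccExtend hb (fun t => (v t)⁻¹)
  have hy : Continuous y := by
    refine Continuous.Icc_extend' ?_
    exact continuousOn_iff_continuous_domRestrict.1 (hv.inv₀ fun t ht => (hpos t ht).ne')
  have hyeq : ∀ t ∈ Icc 0 b, y t = (v t)⁻¹ := fun t ht => IccExtend_of_mem hb _ ht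
  obtain ⟨B, hB0, hB⟩ : ∃ B, 0 < B ∧ ∀ t ∈ Icc 0 b, v t ≤ B := by
    obtain ⟨B, hB⟩ := isCompact_Icc.bddAbove_image hv
    exact ⟨max B 1, by positivity, fun t ht => le_max_of_le_left (hB (mem_image_of_mem v ht))⟩
  have hlow : ∀ t, B⁻¹ ≤ y t := fun t => by
    obtain ⟨s, hs, e⟩ : ∃ s ∈ Icc 0 b, y t = (v s)⁻¹ := ⟨_, (projIcc 0 b hb t).2, rfl⟩
    rw [e]
    exact inv_anti₀ (hpos s hs) (hB s hs)
  set S : ℝ → ℝ := fun t => ∫ s in 0..t, y s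
  have hS : ∀ t, HasDerivAt S (y t) t := fun t => hy.integral_hasStrictDerivAt 0 t |>.hasDerivAt
  have hS0 : S 0 = 0 := by simp [S]
  have hypos : ∀ t, 0 < y t := fun t => (inv_pos.2 hB0).trans_le (hlow t)
  have hmono : StrictMono S := strictMono_of_deriv_pos fun t => by
    rw [(hS t).deriv]; exact hypos t
  -- Since `1 / v ≥ 1 / B`, `S` grows at least linearly, hence is onto.
  have hm : Monotone fun t => S t - B⁻¹ * t := by
    have hd : ∀ t, HasDerivAt (fun t => S t - B⁻¹ * t) (y t - B⁻¹) t := fun t => by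
      simpa using! (hS t).sub ((hasDerivAt_id t).const_mul B⁻¹)
    refine monotone_of_deriv_nonneg (fun t => (hd t).differentiableAt) fun t => ?_
    rw [(hd t).deriv]; linarith [hlow t]
  have hcont : Continuous S := continuous_iff_continuousAt.2 fun t => (hS t).continuousAt
  have hsurj : Function.Surjective S := by
    refine hcont.surjective ?_ ?_
    · refine tendsto_atTop_mono' _ ?_ (tendsto_id.const_mul_atTop (inv_pos.2 hB0))
      filter_upwards [eventually_ge_atTop 0] with t ht
      have := hm ht
      simp only [hS0, id] at this ⊢; linarith
    · refine tendsto_atBot_mono' _ ?_ (tendsto_id.const_mul_atBot (inv_pos.2 hB0))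
      filter_upwards [eventually_le_atBot 0] with t ht
      have := hm ht
      simp only [hS0, id] at this ⊢; linarith
  set o := hmono.orderIsoOfSurjective S hsurj
  have ho' : ∀ t, S (o.symm t) = t := fun t => o.apply_symm_apply t
  have ho'' : ∀ t, o.symm (S t) = t := fun t => o.symm_apply_apply t
  refine ⟨S b, hS0.symm.trans_le (hmono.monotone hb), o.symm, by simpa only [hS0] using ho'' 0, ho'' b,
    fun τ hτ => ?_⟩
  have hmem : o.symm τ ∈ Icc 0 b := by
    refine ⟨?_, ?_⟩ <;> rw [← hmono.le_iff_le, ho']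
    exacts [hS0.trans_le hτ.1, hτ.2]
  refine ⟨hmem, ?_, fun hlt => by rwa [← hmono.lt_iff_lt, ho']⟩
  have := (hS (o.symm τ)).of_local_left_inverse o.symm.continuous.continuousAt (hypos _).ne'
    (Eventually.of_forall ho')
  rwa [hyeq _ hmem, inv_inv] at this

/-- Along the curve `ε₁ = c / (R - t)` is strictly increasing, so the section is met only at `t =
b`. -/
theorem isExitPoint_of_solution {X Y : ℝ × ℝ × ℝ → ℝ} {U : Set (ℝ × ℝ × ℝ)} {R c e b : ℝ}
    {α : ℝ → ℝ} (hc : 0 < c) (he : 0 < e) (hb : 0 ≤ b) (hbe : e * (R - b) = c)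
    (hY : ContinuousOn Y U)
    (hα : ∀ t ∈ Icc 0 b, HasDerivWithinAt α ((R - t) * (X (α t, R - t, c / (R - t)) /
      Y (α t, R - t, c / (R - t)))) (Icc 0 b) t)
    (hU : ∀ t ∈ Icc 0 b, (α t, R - t, c / (R - t)) ∈ U)
    (hpos : ∀ t ∈ Icc 0 b, 0 < Y (α t, R - t, c / (R - t))) :
    IsExitPoint X Y U e (α 0, R, c / R) (α b, R - b, e) := by
  have hRb : 0 < R - b := by
    by_contra hn
    nlinarith
  have hR : ∀ t ∈ Icc 0 b, 0 < R - t := fun t ht => by linarith [ht.2]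
  have hp : ContinuousOn (fun t => (α t, R - t, c / (R - t))) (Icc 0 b) :=
    ContinuousOn.prodMk (fun t ht => (hα t ht).continuousWithinAt)
      ((continuousOn_const.sub continuousOn_id).prodMk
        (continuousOn_const.div (continuousOn_const.sub continuousOn_id)
          fun t ht => (hR t ht).ne'))
  -- In original time, `t = R - r₁` advances at speed `r₁ Y`.
  obtain ⟨S, hS, σ, h0, h1, hσ⟩ := exists_time_change hb
    (v := fun t => (R - t) * Y (α t, R - t, c / (R - t)))
    ((continuousOn_const.sub continuousOn_id).mul (hY.comp hp hU))
    (fun t ht => mul_pos (hR t ht) (hpos t ht))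
  refine ⟨S, fun τ => (α (σ τ), R - σ τ, c / (R - σ τ)), hS, fun τ hτ => ?_,
    fun τ hτ => hU _ (hσ τ hτ).1, by simp [h0], ?_, rfl, fun τ hτ => ?_⟩
  · obtain ⟨hm, hd, -⟩ := hσ τ hτ
    have hd' := hd.hasDerivWithinAt (s := Icc 0 S)
    have d1 := (hα _ hm).comp τ hd' (fun s hs => (hσ s hs).1)
    have d2 := hd'.const_sub R
    have d3 := (hasDerivWithinAt_const τ (Icc 0 S) c).div d2 (hR _ hm).ne'
    refine (d1.prodMk (d2.prodMk d3)).congr_deriv ?_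
    have y0 := (hpos _ hm).ne'
    have r0 := (hR _ hm).ne'
    simp only [edgeField, Prod.mk.injEq]
    refine ⟨?_, ?_, ?_⟩
    · field_simp
    · ring
    · field_simp; ring
  · simp only [h1]
    rw [← hbe, mul_div_cancel_right₀ _ hRb.ne']
  · obtain ⟨hm, -, hlt⟩ := hσ τ (Ico_subset_Icc_self hτ)
    have := hlt hτ.2
    have r0 := hR _ hm
    simp only
    rw [← hbe]
    intro heq
    rw [div_eq_iff r0.ne'] at heq
    nlinarith [mul_left_cancel₀ he.ne' heq]

theorem exists_lipschitzOnWith_of_contDiffOn {f : ℝ × ℝ × ℝ → ℝ × ℝ × ℝ} {U K : Set (ℝ × ℝ × ℝ)}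
    (hU : IsOpen U) (hf : ContDiffOn ℝ 1 f U) (hK : IsCompact K) (hKU : K ⊆ U) :
    ∃ L, LipschitzOnWith L f K := by
  refine LocallyLipschitzOn.exists_lipschitzOnWith_of_compact hK fun x hx => ?_
  obtain ⟨L, t, ht, hl⟩ := (hf.contDiffAt (hU.mem_nhds (hKU hx))).exists_lipschitzOnWith
  exact ⟨L, t, mem_nhdsWithin_of_mem_nhds ht, hl⟩

/-- The field is Lipschitz on the compact union of the two traces, so the curves agree on the
shorter interval; a strictly longer one would meet the section before its own first arrival. -/
theorem IsExitPoint.unique {X Y : ℝ × ℝ × ℝ → ℝ} {U : Set (ℝ × ℝ × ℝ)} {e : ℝ}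
    {p q q' : ℝ × ℝ × ℝ} (hU : IsOpen U) (hX : ContDiffOn ℝ 1 X U) (hY : ContDiffOn ℝ 1 Y U)
    (hq : IsExitPoint X Y U e p q) (hq' : IsExitPoint X Y U e p q') : q = q' := by
  obtain ⟨T, γ, hT, hγ, hγU, h0, h1, he, hne⟩ := hq
  obtain ⟨T', γ', hT', hγ', hγU', h0', h1', he', hne'⟩ := hq'
  wlog hle : T ≤ T' generalizing T T' γ γ' q q'
  · exact (this T' γ' hT' hγ' hγU' h0' h1' he' hne' T γ hT hγ hγU h0 h1 he hne
      (le_of_not_ge hle)).symm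
  have hf : ContDiffOn ℝ 1 (edgeField X Y) U := by
    unfold edgeField
    exact ContDiffOn.prodMk ((contDiff_fst.comp contDiff_snd).contDiffOn.pow 2 |>.mul hX)
      (((contDiff_fst.comp contDiff_snd).contDiffOn.neg.mul hY).prodMk
        ((contDiff_snd.comp contDiff_snd).contDiffOn.mul hY))
  have hc : ContinuousOn γ (Icc 0 T) := fun t ht => (hγ t ht).continuousWithinAt
  have hc' : ContinuousOn γ' (Icc 0 T') := fun t ht => (hγ' t ht).continuousWithinAt
  obtain ⟨L, hL⟩ := exists_lipschitzOnWith_of_contDiffOn hU hf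
    ((isCompact_Icc.image_of_continuousOn hc).union (isCompact_Icc.image_of_continuousOn hc'))
    (union_subset (image_subset_iff.2 hγU) (image_subset_iff.2 hγU'))
  have hsub : Icc 0 T ⊆ Icc 0 T' := Icc_subset_Icc_right hle
  have heq := ODE_solution_unique_of_mem_Icc_right (v := fun _ => edgeField X Y)
    (s := fun _ => γ '' Icc 0 T ∪ γ' '' Icc 0 T') (fun _ _ => hL) hc
    (fun t ht => (hγ t (Ico_subset_Icc_self ht)).mono_of_mem_nhdsWithin
        (mem_of_superset (Icc_mem_nhdsGE ht.2) (Icc_subset_Icc_left ht.1)))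
    (fun t ht => Or.inl (mem_image_of_mem _ (Ico_subset_Icc_self ht)))
    (hc'.mono hsub)
    (fun t ht => (hγ' t (hsub (Ico_subset_Icc_self ht))).mono_of_mem_nhdsWithin
        (mem_of_superset (Icc_mem_nhdsGE (ht.2.trans_le hle)) (Icc_subset_Icc_left ht.1)))
    (fun t ht => Or.inr (mem_image_of_mem _ (hsub (Ico_subset_Icc_self ht))))
    (h0.trans h0'.symm)
  have hTT : γ T = γ' T := heq ⟨hT, le_rfl⟩
  rcases hle.eq_or_lt with rfl | hlt
  · rw [← h1, ← h1', hTT]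
  · exact absurd (by rw [← hTT, h1, he]) (hne' T ⟨hT, hlt⟩)

theorem transitionMap_eq {X Y : ℝ × ℝ × ℝ → ℝ} {U : Set (ℝ × ℝ × ℝ)} {e : ℝ}
    {p q : ℝ × ℝ × ℝ} (hU : IsOpen U) (hX : ContDiffOn ℝ 1 X U) (hY : ContDiffOn ℝ 1 Y U)
    (hq : IsExitPoint X Y U e p q) : transitionMap X Y U e p = q := by
  have h : ∃ q, IsExitPoint X Y U e p q := ⟨q, hq⟩
  rw [transitionMap, dif_pos h]
  exact h.choose_spec.unique hU hX hY hq

/-! ### Localization near the equilibria and derivative estimates. -/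

theorem ContDiffOn.exists_contDiff_hasCompactSupport_eqOn {F : ℝ × ℝ × ℝ → ℝ}
    {U K : Set (ℝ × ℝ × ℝ)} (hF : ContDiffOn ℝ ∞ F U) (hU : IsOpen U) (hK : IsCompact K)
    (hKU : K ⊆ U) : ∃ G : ℝ × ℝ × ℝ → ℝ, ContDiff ℝ ∞ G ∧ HasCompactSupport G ∧ EqOn G F K := by
  obtain ⟨K', hK', hKK', hK'U⟩ := exists_compact_between hK hU hKU
  obtain ⟨f, hf0, hf1, -⟩ := exists_contMDiffMap_zero_one_nhds_of_isClosed (n := ⊤)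
    (modelWithCornersSelf ℝ (ℝ × ℝ × ℝ)) (isOpen_interior (s := K')).isClosed_compl hK.isClosed
    (disjoint_compl_left_iff_subset.2 hKK')
  have hf : ContDiff ℝ ∞ f := f.contMDiff.contDiff
  have h0 : ∀ p ∉ interior K', ∀ᶠ y in 𝓝 p, f y = 0 := fun p hp =>
    Filter.eventually_of_mem (nhds_le_nhdsSet (mem_compl hp) hf0) fun y hy => hy
  refine ⟨fun p => f p * F p, contDiff_iff_contDiffAt.2 fun p => ?_, ?_, fun p hp => ?_⟩
  · by_cases hp : p ∈ interior K'
    · exact hf.contDiffAt.mul (hF.contDiffAt (hU.mem_nhds (hK'U (interior_subset hp))))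
    · refine (contDiffAt_const (c := (0 : ℝ))).congr_of_eventuallyEq ?_
      filter_upwards [h0 p hp] with y hy
      rw [hy, zero_mul]
  · refine HasCompactSupport.intro hK' fun p hp => ?_
    rw [(h0 p fun h => hp (interior_subset h)).self_of_nhds, zero_mul]
  · have h1 : ∀ᶠ y in 𝓝 p, f y = 1 := nhds_le_nhdsSet hp hf1
    have : f p = 1 := h1.self_of_nhds
    simp only [this, one_mul]

/-- The `x`-derivatives of the flow are bounded over bounded sets of initial points, and Lipschitz
in the parameter and the time. -/
theorem Tame.iteratedDeriv_flow_estimates {T : ℝ} {Φ : ℝ → ℝ → ℝ → ℝ} {k : ℕ}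
    (hΦ : Tame T k (fun c t x => Φ c t x - x)) {V : Set ℝ} (hV : Bornology.IsBounded V) :
    ∃ C : ℝ, 0 ≤ C ∧ (∀ c, ∀ t ∈ Icc 0 T, ∀ x ∈ V, |iteratedDeriv k (Φ c t) x| ≤ C) ∧
      ∀ c c' x, ∀ t ∈ Icc 0 T, ∀ t' ∈ Icc 0 T,
        |iteratedDeriv k (Φ c t) x - iteratedDeriv k (Φ c' t') x| ≤
          C * (|c - c'| + |t - t'|) := by
  obtain ⟨K, hK, b, l⟩ := hΦ.bddLip_iteratedDeriv
  obtain ⟨B, hB0, hB⟩ := hV.exists_pos_norm_le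
  have split : ∀ c x, ∀ t ∈ Icc 0 T, iteratedDeriv k (Φ c t) x =
      iteratedDeriv k (fun x => Φ c t x - x) x + iteratedDeriv k id x := by
    intro c x t ht
    rw [← iteratedDeriv_add (hΦ.contDiff c ht).contDiffAt contDiff_id.contDiffAt]
    congr 1
    ext y
    simp
  refine ⟨K + B + 1, by positivity, fun c t ht x hx => ?_, fun c c' x t ht t' ht' => ?_⟩
  · rw [split c x t ht]
    have h2 : |iteratedDeriv k id x| ≤ B + 1 := by
      have := hB x hx
      rw [Real.norm_eq_abs] at this
      rw [iteratedDeriv_id]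
      split_ifs
      · linarith
      · rw [abs_one]; linarith
      · rw [abs_zero]; linarith
    refine (abs_add_le _ _).trans ((add_le_add (b c x t ht) h2).trans ?_)
    linarith
  · rw [split c x t ht, split c' x t' ht', add_sub_add_right_eq_sub]
    have := l c c' x x t ht t' ht'
    rw [sub_self x, abs_zero, add_zero] at this
    refine this.trans ?_
    gcongr
    linarith

/-- Near the equilibria, the transition map is given by the flow of `blowupField`. -/
theorem exists_blowup_description {X Y : ℝ × ℝ × ℝ → ℝ} {U : Set (ℝ × ℝ × ℝ)} (hU : IsOpen U)
    (hX : ContDiffOn ℝ ∞ X U) (hY : ContDiffOn ℝ ∞ Y U) {J : Set ℝ} (hJ : IsCompact J)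
    (hJU : ∀ x ∈ J, (x, 0, 0) ∈ U) (hYpos : ∀ x ∈ J, 0 < Y (x, 0, 0)) :
    ∃ δ : ℝ, 0 < δ ∧ ∃ V : Set ℝ, IsOpen V ∧ Bornology.IsBounded V ∧ J ⊆ V ∧
      ∀ R e₁₀ : ℝ, 0 < R → R < δ → 0 < e₁₀ → e₁₀ < δ → ∃ Φ : ℝ → ℝ → ℝ → ℝ,
        (∀ k, Tame R k (fun c t x => Φ c t x - x)) ∧
        ∀ x ∈ V, ∀ e ∈ Ioc 0 e₁₀, IsExitPoint X Y U e₁₀ (x, R, e)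
          (Φ (R * e) (R - R * e / e₁₀) x, R * e / e₁₀, e₁₀) := by
  have hU' : IsOpen (U ∩ Y ⁻¹' Ioi 0) := hY.continuousOn.isOpen_inter_preimage hU isOpen_Ioi
  have hJ' : IsCompact (J ×ˢ {((0 : ℝ), (0 : ℝ))}) := hJ.prod isCompact_singleton
  have hJU' : J ×ˢ {((0 : ℝ), (0 : ℝ))} ⊆ U ∩ Y ⁻¹' Ioi 0 := by
    rintro ⟨x, p⟩ ⟨hx, rfl⟩
    exact ⟨hJU x hx, hYpos x hx⟩
  obtain ⟨η, hη, hηU⟩ := hJ'.exists_cthickening_subset_open hU' hJU'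
  have hF : ContDiffOn ℝ ∞ (fun p => X p / Y p) (U ∩ Y ⁻¹' Ioi 0) :=
    (hX.mono inter_subset_left).div (hY.mono inter_subset_left) fun p hp => (ne_of_gt hp.2)
  obtain ⟨G, hG, hGs, hGF⟩ := hF.exists_contDiff_hasCompactSupport_eqOn hU' hJ'.cthickening hηU
  obtain ⟨M, hM⟩ := hGs.exists_bound_of_continuous hG.continuous
  have hM0 : 0 ≤ M := (norm_nonneg _).trans (hM 0)
  -- `R < 1` and `R < η / (2(M + 1))` keep the drift in `x` below `η / 2`; `V` uses the other half
  -- of `η`. The bound by `η` controls `r₁` and `ε₁`.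
  refine ⟨min 1 (min η (η / (2 * (M + 1)))), by positivity, Metric.thickening (η / 2) J,
    Metric.isOpen_thickening, hJ.isBounded.thickening, Metric.self_subset_thickening (by positivity) J,
    fun R e₁₀ hR hRδ he₁₀ heδ => ?_⟩
  obtain ⟨hR1, hRη, hRM⟩ : R < 1 ∧ R < η ∧ R < η / (2 * (M + 1)) := by simpa using hRδ
  have heη : e₁₀ < η := heδ.trans_le ((min_le_right _ _).trans (min_le_left _ _))
  obtain ⟨Φ, hΦ, hT⟩ := exists_blowup_flow hR.le hG hGs
  refine ⟨Φ, hT, fun x hx e he => ?_⟩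
  obtain ⟨j, hj, hxj⟩ := Metric.mem_thickening_iff.1 hx
  have hlam : R * e / e₁₀ ≤ R := by
    rw [div_le_iff₀ he₁₀]; gcongr; exact he.2
  have hpos : 0 < R * e / e₁₀ := div_pos (mul_pos hR he.1) he₁₀
  have hsub : Icc 0 (R - R * e / e₁₀) ⊆ Icc 0 R := Icc_subset_Icc_right (by linarith)
  -- The solution stays where `G = X / Y`, so the cutoff is invisible to it.
  have hmem : ∀ t ∈ Icc 0 (R - R * e / e₁₀), (Φ (R * e) t x, R - t, R * e / (R - t)) ∈
      Metric.cthickening η (J ×ˢ {((0 : ℝ), (0 : ℝ))}) := by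
    intro t ht
    refine Metric.mem_cthickening_of_dist_le _ (j, 0, 0) _ _ ⟨hj, rfl⟩ ?_
    have hrt : 0 < R - t := by linarith [ht.2]
    have hdisp : |Φ (R * e) t x - Φ (R * e) 0 x| ≤ R * M * |t - 0| :=
      (convex_Icc 0 R).norm_image_sub_le_of_norm_hasDerivWithin_le (hΦ (R * e) x).2
        (fun s hs => by
          rw [blowupField, norm_mul, Real.norm_of_nonneg (by linarith [hs.2])]
          gcongr
          exacts [by linarith [hs.1], hM _]) ⟨le_rfl, hR.le⟩ (hsub ht)
    rw [(hΦ _ _).1, sub_zero, abs_of_nonneg ht.1] at hdisp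
    have h1 : R * M * t ≤ η / 2 := by
      rw [lt_div_iff₀ (by positivity)] at hRM
      have : R * M * t ≤ R * M * 1 := by
        gcongr; linarith
      nlinarith
    rw [Real.dist_eq] at hxj
    simp only [Prod.dist_eq, Real.dist_eq, sub_zero]
    refine max_le ?_ (max_le ?_ ?_)
    · exact (abs_sub_le _ x _).trans (by linarith)
    · rw [abs_of_pos hrt]; linarith [ht.1]
    · rw [abs_of_pos (div_pos (mul_pos hR he.1) hrt), div_le_iff₀ hrt]
      have : R * e = e₁₀ * (R * e / e₁₀) := by field_simp
      calc R * e = e₁₀ * (R * e / e₁₀) := this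
        _ ≤ η * (R - t) := by gcongr; linarith [ht.2]
  have key := isExitPoint_of_solution (X := X) (Y := Y) (U := U) (R := R) (c := R * e) (e := e₁₀)
    (b := R - R * e / e₁₀) (α := fun t => Φ (R * e) t x) (mul_pos hR he.1) he₁₀ (by linarith)
    (by field_simp; ring) hY.continuousOn
    (fun t ht => (((hΦ (R * e) x).2 t (hsub ht)).mono hsub).congr_deriv (by
      rw [blowupField, hGF (hmem t ht)]))
    (fun t ht => (hηU (hmem t ht)).1) (fun t ht => (hηU (hmem t ht)).2)
  simpa only [(hΦ _ _).1, mul_div_cancel_left₀ _ hR.ne', sub_sub_cancel] using key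

/-! ### Conclusion from Lipschitz dependence on `ε₁`. -/

theorem mainTheorem6 (X Y : ℝ × ℝ × ℝ → ℝ) (U : Set (ℝ × ℝ × ℝ)) (hU : IsOpen U)
    (hX : ContDiffOn ℝ ∞ X U) (hY : ContDiffOn ℝ ∞ Y U)
    (J : Set ℝ) (hJ : IsCompact J) (hJU : ∀ x ∈ J, (x, 0, 0) ∈ U)
    (hYpos : ∀ x ∈ J, 0 < Y (x, 0, 0)) (n : ℕ) :
    ∃ δ : ℝ, 0 < δ ∧ ∃ V : Set ℝ, IsOpen V ∧ J ⊆ V ∧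
      ∀ r₁₀ e₁₀ : ℝ, 0 < r₁₀ → r₁₀ < δ → 0 < e₁₀ → e₁₀ < δ →
        -- the transition map is well defined
        (∀ x ∈ V, ∀ e ∈ Ioc 0 e₁₀, ∃! q, IsExitPoint X Y U e₁₀ (x, r₁₀, e) q) ∧
        -- its x-component is `C^n` in `x`
        (∀ e ∈ Ioc 0 e₁₀, ContDiffOn ℝ n (fun x => (transitionMap X Y U e₁₀ (x, r₁₀, e)).1) V) ∧
        -- uniformly in `ε₁`
        (∃ M : ℝ, ∀ k ≤ n, ∀ e ∈ Ioc 0 e₁₀, ∀ x ∈ V,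
          |iteratedDeriv k (fun x => (transitionMap X Y U e₁₀ (x, r₁₀, e)).1) x| ≤ M) ∧
        -- and continuously in `ε₁`
        (∀ k ≤ n, ∀ e ∈ Ioc 0 e₁₀,
          TendstoUniformlyOn
            (fun e' => iteratedDeriv k (fun x => (transitionMap X Y U e₁₀ (x, r₁₀, e')).1))
            (iteratedDeriv k (fun x => (transitionMap X Y U e₁₀ (x, r₁₀, e)).1))
            (𝓝[Ioc 0 e₁₀] e) V) ∧
        -- the expansion as `ε₁ → 0`, and its derivatives with respect to `x`
        ∃ g₀ : ℝ → ℝ, ContDiffOn ℝ ∞ g₀ V ∧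
          ∃ C : ℝ, ∀ᶠ e in 𝓝[>] (0 : ℝ), ∀ k ≤ n, ∀ x ∈ V,
            |iteratedDeriv k (fun x => (transitionMap X Y U e₁₀ (x, r₁₀, e)).1) x
              - iteratedDeriv k g₀ x| ≤ C * (e * Real.log e⁻¹) := by
  obtain ⟨δ, hδ, V, hV, hVb, hJV, hmain⟩ := exists_blowup_description hU hX hY hJ hJU hYpos
  refine ⟨δ, hδ, V, hV, hJV, fun R e₁₀ hR hRδ he₁₀ heδ => ?_⟩
  obtain ⟨Φ, hT, hexit⟩ := hmain R e₁₀ hR hRδ he₁₀ heδ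
  have hX1 : ContDiffOn ℝ 1 X U := hX.of_le (by simp)
  have hY1 : ContDiffOn ℝ 1 Y U := hY.of_le (by simp)
  have hQ : ∀ e ∈ Ioc 0 e₁₀, EqOn (fun x => (transitionMap X Y U e₁₀ (x, R, e)).1)
      (Φ (R * e) (R - R * e / e₁₀)) V := fun e he x hx => by
    simp only [transitionMap_eq hU hX1 hY1 (hexit x hx e he)]
  have hQd : ∀ k, ∀ e ∈ Ioc 0 e₁₀, ∀ x ∈ V,
      iteratedDeriv k (fun x => (transitionMap X Y U e₁₀ (x, R, e)).1) x =
        iteratedDeriv k (Φ (R * e) (R - R * e / e₁₀)) x :=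
    fun k e he x hx => (hQ e he).iteratedDeriv_of_isOpen hV k hx
  have hmem : ∀ e ∈ Icc 0 e₁₀, R - R * e / e₁₀ ∈ Icc 0 R := fun e he => by
    have h1 : R * e / e₁₀ ≤ R := by rw [div_le_iff₀ he₁₀]; gcongr; exact he.2
    have h2 : 0 ≤ R * e / e₁₀ := div_nonneg (mul_nonneg hR.le he.1) he₁₀.le
    exact ⟨by linarith, by linarith⟩
  have hsmooth : ∀ (k : ℕ) (c : ℝ), ∀ t ∈ Icc 0 R, ContDiff ℝ k (Φ c t) := fun k c t ht => by
    have := ((hT k).contDiff c ht).add contDiff_id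
    simpa using! this
  choose C hC0 hCb hCl using fun k => (hT k).iteratedDeriv_flow_estimates hVb
  set A : ℝ := ∑ k ∈ Finset.range (n + 1), C k
  have hA : ∀ k ≤ n, C k ≤ A := fun k hk =>
    Finset.single_le_sum (fun i _ => hC0 i) (Finset.mem_range.2 (Nat.lt_succ_of_le hk))
  have hA0 : 0 ≤ A := Finset.sum_nonneg fun i _ => hC0 i
  -- `R` and `R / e₁₀` are the Lipschitz constants of `e ↦ R e` and `e ↦ R - R e / e₁₀`.
  set D : ℝ := A * (R + R / e₁₀)
  have hD0 : 0 ≤ D := by positivity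
  -- The closed interval matters: `e' = 0` yields the expansion, with `g₀` the flow for `c = 0` run
  -- down to `r = 0`.
  have hlip : ∀ k ≤ n, ∀ e ∈ Icc 0 e₁₀, ∀ e' ∈ Icc 0 e₁₀, ∀ x,
      |iteratedDeriv k (Φ (R * e) (R - R * e / e₁₀)) x -
        iteratedDeriv k (Φ (R * e') (R - R * e' / e₁₀)) x| ≤ D * |e - e'| := by
    intro k hk e he e' he' x
    refine (hCl k _ _ x _ (hmem e he) _ (hmem e' he')).trans ?_
    have h1 : R * e - R * e' = R * (e - e') := by ring
    have h2 : R - R * e / e₁₀ - (R - R * e' / e₁₀) = -(R / e₁₀ * (e - e')) := by ring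
    rw [h1, h2, abs_neg, abs_mul, abs_mul, abs_of_pos hR, abs_of_pos (div_pos hR he₁₀), ← add_mul,
      ← mul_assoc]
    exact mul_le_mul_of_nonneg_right
      (mul_le_mul_of_nonneg_right (hA k hk) (by positivity)) (abs_nonneg _)
  refine ⟨fun x hx e he => ⟨_, hexit x hx e he, fun q hq => hq.unique hU hX1 hY1 (hexit x hx e he)⟩,
    fun e he => (hsmooth n _ _ (hmem e (Ioc_subset_Icc_self he))).contDiffOn.congr (hQ e he),
    ⟨A, fun k hk e he x hx => ?_⟩, fun k hk e he => ?_,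
    Φ (R * 0) (R - R * 0 / e₁₀), ?_, D, ?_⟩
  · rw [hQd k e he x hx]
    exact (hCb k _ _ (hmem e (Ioc_subset_Icc_self he)) x hx).trans (hA k hk)
  · rw [Metric.tendstoUniformlyOn_iff]
    intro ε hε
    have : ∀ᶠ e' in 𝓝[Ioc 0 e₁₀] e, D * |e - e'| < ε := by
      refine mem_nhdsWithin_of_mem_nhds ?_
      have hc : Tendsto (fun e' => D * |e - e'|) (𝓝 e) (𝓝 (D * |e - e|)) :=
        (Continuous.tendsto (by fun_prop) e)
      rw [sub_self, abs_zero, mul_zero] at hc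
      exact hc.eventually (gt_mem_nhds hε)
    filter_upwards [this, self_mem_nhdsWithin] with e' h1 he' x hx
    rw [hQd k e he x hx, hQd k e' he' x hx, Real.dist_eq]
    exact (hlip k hk e (Ioc_subset_Icc_self he) e' (Ioc_subset_Icc_self he') x).trans_lt h1
  · exact (contDiff_infty.2 fun k => hsmooth k _ _ (hmem 0 ⟨le_rfl, he₁₀.le⟩)).contDiffOn
  -- Below `exp (-1)` one has `log e⁻¹ ≥ 1`, so the bound `D e` implies the one with the logarithm.
  · filter_upwards [Ioo_mem_nhdsGT (show 0 < min e₁₀ (Real.exp (-1)) by positivity)]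
      with e he k hk x hx
    have he1 : e < e₁₀ := he.2.trans_le (min_le_left _ _)
    have he2 : e < Real.exp (-1) := he.2.trans_le (min_le_right _ _)
    rw [hQd k e ⟨he.1, he1.le⟩ x hx]
    refine (hlip k hk e ⟨he.1.le, he1.le⟩ 0 ⟨le_rfl, he₁₀.le⟩ x).trans ?_
    rw [sub_zero, abs_of_pos he.1]
    have hlog : 1 ≤ Real.log e⁻¹ := by
      have := Real.log_lt_log he.1 he2
      rw [Real.log_exp] at this
      rw [Real.log_inv]; linarith
    gcongr
    exact le_mul_of_one_le_right he.1.le hlog
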